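/- Fix a Grothendieck universe $\mathfrak U$ ("small" means $\mathfrak U$-small). Let $\mathcal C$ be a category and $J$ a Grothendieck topology on $\mathcal C$. **Notions.** * A collection $\mathcal T$ of morphisms of $\mathcal C$ is *semi-localizing* if it contains all identities, is closed under composition, and for every diagram $Y_1\xrightarrow{f_1}X\xleftarrow{f_2}Y_2$ with $f_1\in\mathcal T$ there are $g_1:Z\to Y_1$ and $g_2:Z\to Y_2$ with $g_2\in\mathcal T$ and $f_1g_1=f_2g_2$. The topology $J$ is an *$A$-topology* if there is a semi-localizing $\mathcal T$ such that, for every $X$, a sieve on $X$ is $J$-covering if and only if it contains a morphism of $\mathcal T$. * $\mathcal T(J)$ is the collection of morphisms $f:Y\to X$ such that the sieve of all morphisms to $X$ that factor through $f$ is $J$-covering. $\mathcal C(\mathcal T(J))$ is the subcategory of $\mathcal C$ with all objects of $\mathcal C$ and with the morphisms belonging to $\mathcal T(J)$. * For a collection $\mathcal T$ of morphisms, $\widehat{\mathcal T}$ is the collection of morphisms $f$ such that $f\circ g\in\mathcal T$ for some morphism $g$. * A morphism $f:Y\to X$ is a *Galois covering* if there are a group $G$ and a homomorphism $\rho:G\to\operatorname{Aut}_X(Y)$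 such that for every object $Z$ the group $G$, acting by composition with $\rho(g)$, acts freely on $\operatorname{Hom}(Z,Y)$, and the map $G\backslash\operatorname{Hom}(Z,Y)\to\operatorname{Hom}(Z,X)$ induced by composition with $f$ is injective. $\mathcal T$ *has enough Galois coverings* if $\widehat{\mathcal T'}=\widehat{\mathcal T}$, where $\mathcal T'$ is the collection of the Galois coverings belonging to $\mathcal T$. * A category is *$\Lambda$-connected* if for any two objects $X,Y$ there are an object $Z$ and morphisms $Z\to X$, $Z\to Y$. * $(\mathcal C,J)$ is a *$Y$-site* if every morphism of $\mathcal C$ is an epimorphism; $J$ is an $A$-topology; for all composable $Z\xrightarrow{g}Y\xrightarrow{f}X$ one has $f\circ g\in\mathcal T(J)$ if and only if $f,g\in\mathcal T(J)$; $\mathcal C$ is essentially small; $\mathcal C(\mathcal T(J))$ is $\Lambda$-connected; and $\mathcal T(J)$ has enough Galois coverings. * A *grid* of a $Y$-site $(\mathcal C,J)$ is a pair $(\mathcal C_0,\iota_0)$ of a small partially ordered set $\mathcal C_0$, regarded as a category with a (unique) morphism $x\to y$ exactly when $x\le y$, and a functor $\iota_0:\mathcal C_0\to\mathcal C$ such that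 (1) $\mathcal C_0$ is $\Lambda$-connected; (2) every object of $\mathcal C$ is isomorphic to $\iota_0(X)$ for some *edge object* $X$ of $\mathcal C_0$, i.e. an object $X$ such that $\iota_0(f)\in\mathcal T(J)$ for every morphism $f$ of $\mathcal C_0$ with target $X$; (3) for every object $X$ of $\mathcal C_0$ and every $f:Y\to\iota_0(X)$ in $\mathcal T(J)$ there are a morphism $f':Y'\to X$ in $\mathcal C_0$ and an isomorphism $\alpha:Y\to\iota_0(Y')$ with $f=\iota_0(f')\circ\alpha$; (4) for every object $X$ of $\mathcal C_0$ the functor of undercategories $\mathcal C_{0,X/}\to\mathcal C_{\iota_0(X)/}$ induced by $\iota_0$ is an equivalence of categories. **Proposition.** Let $(\mathcal C,J)$ be a $Y$-site. Suppose that there is an object $X_0$ of $\mathcal C(\mathcal T(J))$ such that the overcategory $\mathcal D=\mathcal C(\mathcal T(J))_{/X_0}$ satisfies at least one of the following two conditions: 1. for any objects $X,Y$ of $\mathcal D$ the set $\operatorname{Hom}_{\mathcal D}(X,Y)$ is finite; 2. there is an at most countable set $S$ of objects of $\mathcal D$ such that every object of $\mathcal D$ receives a morphism from an object belonging to $S$.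 Then there exists a grid of $(\mathcal C,J)$. -/

import Mathlib

open CategoryTheory

universe w v u

namespace YSite

section SemiLocalizing

variable {C : Type u} [Category.{v} C]

/-- A collection of morphisms containing the identities, closed under composition and satisfying
the right Ore condition. -/
structure IsSemiLocalizing (T : MorphismProperty C) : Prop where
  id_mem : ∀ X : C, T (𝟙 X)
  comp_mem : ∀ {X Y Z : C} (g : Z ⟶ Y) (f : Y ⟶ X), T g → T f → T (g ≫ f)
  ore : ∀ {X Y₁ Y₂ : C} (f₁ : Y₁ ⟶ X) (f₂ : Y₂ ⟶ X), T f₁ →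
    ∃ (Z : C) (g₁ : Z ⟶ Y₁) (g₂ : Z ⟶ Y₂), T g₂ ∧ g₁ ≫ f₁ = g₂ ≫ f₂

/-- The sieves on `X` that contain a morphism belonging to `T`. -/
def coveringSieves (T : MorphismProperty C) (X : C) : Set (Sieve X) :=
  {R | ∃ (Y : C) (f : Y ⟶ X), R f ∧ T f}

/-- The morphisms `f` such that `f ∘ g` belongs to `T` for some morphism `g`. -/
def hat (T : MorphismProperty C) : MorphismProperty C :=
  fun Y _ f => ∃ (Z : C) (g : Z ⟶ Y), T (g ≫ f)

/-- `J` is an `A`-topology: it is the topology given by a semi-localizing collection. -/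
def IsATopology (J : GrothendieckTopology C) : Prop :=
  ∃ T : MorphismProperty C, IsSemiLocalizing T ∧ ∀ X : C, J X = coveringSieves T X

/-- The collection `𝒯(J)` of the morphisms `f : Y ⟶ X` such that the sieve of all the morphisms
that factor through `f` is a covering sieve. -/
def coverMor (J : GrothendieckTopology C) : MorphismProperty C :=
  fun _ X f => Sieve.generate (Presieve.singleton f) ∈ J X

instance coverMor_isMultiplicative (J : GrothendieckTopology C) :
    (coverMor J).IsMultiplicative where
  id_mem X := by
    have h : Sieve.generate (Presieve.singleton (𝟙 X)) = ⊤ := by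
      rw [← Sieve.id_mem_iff_eq_top]
      exact Sieve.le_generate _ _ _ (Presieve.singleton_self _)
    change Sieve.generate (Presieve.singleton (𝟙 X)) ∈ J X
    rw [h]
    exact J.top_mem X
  comp_mem {Z Y X} g f hg hf := by
    change Sieve.generate (Presieve.singleton (g ≫ f)) ∈ J X
    refine J.transitive hf _ ?_
    rintro W _ ⟨_, k, _, ⟨⟩, rfl⟩
    refine J.superset_covering ?_ (J.pullback_stable k hg)
    rintro V l ⟨_, m, _, ⟨⟩, hm⟩
    exact ⟨_, m, _, Presieve.singleton_self _, by rw [← Category.assoc, hm, Category.assoc]⟩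

/-- The category `𝒞(𝒯(J))`: the objects of `C`, with the morphisms that belong to `𝒯(J)`. -/
abbrev CoverCat (J : GrothendieckTopology C) : Type u :=
  WideSubcategory (coverMor J)

end SemiLocalizing

section Galois

/-- A map `φ : S → S'` is a pseudo `G`-torsor: it is `G`-invariant, `G` acts freely on `S`, and
the map from the orbit set to `S'` induced by `φ` is injective. -/
structure IsPseudoTorsor (G : Type*) {S S' : Type*} [Group G] [MulAction G S]
    (φ : S → S') : Prop where
  map_smul : ∀ (g : G) (s : S), φ (g • s) = φ s
  free : ∀ (g : G) (s : S), g • s = s → g = 1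
  orbit : ∀ s t : S, φ s = φ t → MulAction.orbitRel G S s t

variable {C : Type u} [Category.{v} C]

/-- The left action of `G` on `Hom(Z, Y)` by composition with `ρ g ∈ Aut_X(Y)`. -/
abbrev homAction {G : Type*} [Group G] {X Y : C} {f : Y ⟶ X}
    (ρ : G →* Aut (Over.mk f)) (Z : C) : MulAction G (Z ⟶ Y) where
  smul g h := h ≫ (ρ g).hom.left
  one_smul h := by
    change h ≫ (ρ 1).hom.left = h
    rw [map_one]
    exact Category.comp_id h
  mul_smul a b h := by
    change h ≫ (ρ (a * b)).hom.left = (h ≫ (ρ b).hom.left) ≫ (ρ a).hom.left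
    rw [map_mul, Category.assoc]
    rfl

/-- The collection of the Galois coverings of `C`. -/
def galoisCovering (C : Type u) [Category.{v} C] : MorphismProperty C :=
  fun Y X f => ∃ (G : Type v) (_ : Group G) (ρ : G →* Aut (Over.mk f)),
    ∀ Z : C, @IsPseudoTorsor G (Z ⟶ Y) (Z ⟶ X) _ (homAction ρ Z) (fun h => h ≫ f)

/-- `T` has enough Galois coverings: with `T'` the collection of the Galois coverings that belong
to `T`, the collections `hat T'` and `hat T` coincide. -/
def HasEnoughGalois (T : MorphismProperty C) : Prop :=
  hat (T ⊓ galoisCovering C) = hat T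

end Galois

section Sites

/-- Any two objects receive morphisms from a common object. -/
def IsLambdaConnected (D : Type u) [Category.{v} D] : Prop :=
  ∀ X Y : D, ∃ Z : D, Nonempty (Z ⟶ X) ∧ Nonempty (Z ⟶ Y)

variable {C : Type u} [Category.{v} C]

structure IsBSite (J : GrothendieckTopology C) : Prop where
  epi : ∀ {X Y : C} (f : Y ⟶ X), Epi f
  aTopology : IsATopology J
  comp_iff : ∀ {X Y Z : C} (g : Z ⟶ Y) (f : Y ⟶ X),
    coverMor J (g ≫ f) ↔ coverMor J f ∧ coverMor J g

/-- `w` is the universe with respect to which `C` is essentially small. -/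
structure IsYSite (J : GrothendieckTopology C) : Prop extends IsBSite J where
  essentiallySmall : EssentiallySmall.{w} C
  lambdaConnected : IsLambdaConnected (CoverCat J)
  enoughGalois : HasEnoughGalois (coverMor J)

/-- Every hom-set is finite. -/
def CardinalityOne (D : Type u) [Category.{v} D] : Prop :=
  ∀ X Y : D, Finite (X ⟶ Y)

/-- There is an at most countable set of objects such that every object receives a morphism from
a member of it. -/
def CardinalityTwo (D : Type u) [Category.{v} D] : Prop :=
  ∃ S : Set D, S.Countable ∧ ∀ X : D, ∃ Y ∈ S, Nonempty (Y ⟶ X)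

/-- An object `X` of `P` is an edge object if `ι` sends every morphism to `X` into `𝒯(J)`. -/
def IsEdge (J : GrothendieckTopology C) {P : Type w} [PartialOrder P] (ι : P ⥤ C) (X : P) : Prop :=
  ∀ (Y : P) (f : Y ⟶ X), coverMor J (ι.map f)

/-- The poset `P`, regarded as a category with a morphism `x ⟶ y` exactly when `x ≤ y`, and the
functor `ι : P ⥤ C` form a grid of `(C, J)`. -/
structure IsGrid (J : GrothendieckTopology C) {P : Type w} [PartialOrder P] (ι : P ⥤ C) :
    Prop where
  lambdaConnected : IsLambdaConnected P
  exists_edge : ∀ X' : C, ∃ X : P, IsEdge J ι X ∧ Nonempty (ι.obj X ≅ X')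
  exists_lift : ∀ (X : P) (Y : C) (f : Y ⟶ ι.obj X), coverMor J f →
    ∃ (Y' : P) (f' : Y' ⟶ X) (α : Y ≅ ι.obj Y'), f = α.hom ≫ ι.map f'
  under_equiv : ∀ X : P, (Under.post ι : Under X ⥤ Under (ι.obj X)).IsEquivalence

end Sites

end YSite

/-! The grid consists of the germs of morphisms out of a pro-object. Given a cofiltered system `U`
in `C`, take the objects of `C` equipped with a germ of morphisms from `U`, and the morphisms that
preserve germs. Since every morphism is an epimorphism, there is at most one morphism between two
such objects, so they form a poset up to equivalence. A germ pushes forward along any morphism,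
which gives the condition on undercategories. The conditions on edge objects and on lifts hold once
the transition maps lie in `𝒯(J)`, `U` reaches every object through `𝒯(J)`, and germs lift along
`𝒯(J)` (`exists_grid_of_proObject`).

Such a `U` comes from a tower of normal objects of `Over X₀` that maps to every object there; Galois
coverings supply enough normal objects, and normality yields the lifting (`exists_germ_lift`). The
tower (`exists_tower`) is a recursive sequence in the countable case. If hom-sets are finite,
compactness makes transition maps between all the chosen normal objects strictly compatible
(`exists_compatible_homs`). -/

namespace YSite

/-! ### Weakly initial towers of normal objects -/

section Towers

variable {D : Type u} [Category.{v} D]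

/-- The endomorphisms of `Y` act transitively on the morphisms from any given object to `Y`. -/
def IsNormalObj (Y : D) : Prop :=
  ∀ ⦃W : D⦄ (s t : W ⟶ Y), ∃ σ : Y ⟶ Y, t ≫ σ = s

/-- A functor whose values form a family of objects that maps to every object of `D`. -/
def IsWeaklyInitialFunctor {K : Type*} [Category K] (F : K ⥤ D) : Prop :=
  ∀ Y : D, ∃ k : K, Nonempty (F.obj k ⟶ Y)

theorem IsLambdaConnected.exists_hom_finset (hD : IsLambdaConnected D) [Nonempty D]
    {α : Type*} (N : α → D) (s : Finset α) : ∃ Z : D, ∀ a ∈ s, Nonempty (Z ⟶ N a) := by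
  classical
  induction s using Finset.induction_on with
  | empty => exact ⟨Classical.arbitrary D, by simp⟩
  | insert a s _ ih =>
    obtain ⟨Z, hZ⟩ := ih
    obtain ⟨Z', ⟨f⟩, ⟨g⟩⟩ := hD Z (N a)
    refine ⟨Z', fun b hb => ?_⟩
    rcases Finset.mem_insert.1 hb with rfl | hb
    · exact ⟨g⟩
    · exact (hZ b hb).map (f ≫ ·)

/-- For normal objects with finite hom-sets, morphisms can be chosen compatibly with composition. -/
theorem exists_compatible_homs (hepi : ∀ {X Y : D} (f : X ⟶ Y), Epi f)
    (hD : IsLambdaConnected D) [Nonempty D] (hfin : ∀ X Y : D, Finite (X ⟶ Y))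
    {S : Type*} (N : S → D) (hN : ∀ s, IsNormalObj (N s)) :
    ∃ χ : ∀ i j : S, Nonempty (N i ⟶ N j) → (N i ⟶ N j),
      ∀ i j k hij hjk hik, χ i j hij ≫ χ j k hjk = χ i k hik := by
  classical
  let A := {p : S × S // Nonempty (N p.1 ⟶ N p.2)}
  -- For finitely many pairs, a common source `Z` with maps `c` to the objects involved rigidifies
  -- the choice: by normality any morphism can be corrected to one that commutes with `c`.
  have key : ∀ t : Finset A, ∃ g : (a : A) → (N a.1.1 ⟶ N a.1.2),
      ∃ (Z : D) (c : ∀ i : S, (∃ a ∈ t, a.1.1 = i ∨ a.1.2 = i) → (Z ⟶ N i)),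
        ∀ (a : A) (ha : a ∈ t),
          c a.1.1 ⟨a, ha, Or.inl rfl⟩ ≫ g a = c a.1.2 ⟨a, ha, Or.inr rfl⟩ := by
    intro t
    obtain ⟨Z, hZ⟩ := hD.exists_hom_finset N (t.image (·.1.1) ∪ t.image (·.1.2))
    have hc : ∀ i : S, (∃ a ∈ t, a.1.1 = i ∨ a.1.2 = i) → Nonempty (Z ⟶ N i) := by
      rintro i ⟨a, ha, rfl | rfl⟩
      · exact hZ _ (Finset.mem_union_left _ (Finset.mem_image_of_mem _ ha))
      · exact hZ _ (Finset.mem_union_right _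
          (Finset.mem_image_of_mem (fun b : A => b.1.2) ha))
    let c := fun i hi => (hc i hi).some
    have hg : ∀ a : A, ∃ g : N a.1.1 ⟶ N a.1.2, ∀ ha : a ∈ t,
        c a.1.1 ⟨a, ha, Or.inl rfl⟩ ≫ g = c a.1.2 ⟨a, ha, Or.inr rfl⟩ := by
      intro a
      obtain ⟨f⟩ := a.2
      by_cases ha : a ∈ t
      · obtain ⟨σ, hσ⟩ := hN a.1.2 (c a.1.2 ⟨a, ha, Or.inr rfl⟩)
          (c a.1.1 ⟨a, ha, Or.inl rfl⟩ ≫ f)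
        exact ⟨f ≫ σ, fun _ => by rw [← hσ, Category.assoc]⟩
      · exact ⟨f, fun h => absurd h ha⟩
    choose g hg using hg
    exact ⟨g, Z, c, hg⟩
  choose g Z c hg using key
  -- Compactness: on each finite set of pairs `χ` agrees with some `g t`. A composition identity
  -- involves only three pairs, and holds for `g t` after cancelling the epimorphism `c`.
  obtain ⟨χ, hχ⟩ := Finset.rado_selection (β := fun a : A => (N a.1.1 ⟶ N a.1.2)) g
  refine ⟨fun i j h => χ ⟨(i, j), h⟩, fun i j k hij hjk hik => ?_⟩
  obtain ⟨t, hst, ht⟩ := hχ {⟨(i, j), hij⟩, ⟨(j, k), hjk⟩, ⟨(i, k), hik⟩}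
  have h₁ := ht ⟨(i, j), hij⟩ (by simp)
  have h₂ := ht ⟨(j, k), hjk⟩ (by simp)
  have h₃ := ht ⟨(i, k), hik⟩ (by simp)
  have e₁ := hg t ⟨(i, j), hij⟩ (hst (by simp))
  have e₂ := hg t ⟨(j, k), hjk⟩ (hst (by simp))
  have e₃ := hg t ⟨(i, k), hik⟩ (hst (by simp))
  rw [← h₁] at e₁
  rw [← h₂] at e₂
  rw [← h₃] at e₃
  dsimp only at e₁ e₂ e₃
  have := hepi (c t i ⟨⟨(i, j), hij⟩, hst (by simp), Or.inl rfl⟩)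
  rw [← cancel_epi (c t i ⟨⟨(i, j), hij⟩, hst (by simp), Or.inl rfl⟩), ← Category.assoc, e₁, e₂,
    e₃]

theorem exists_tower_of_finite_hom (hepi : ∀ {X Y : D} (f : X ⟶ Y), Epi f)
    (hD : IsLambdaConnected D) [Nonempty D] (hfin : ∀ X Y : D, Finite (X ⟶ Y))
    {S : Type w} (N : S → D) (hN : ∀ s, IsNormalObj (N s))
    (hweak : ∀ Y : D, ∃ s, Nonempty (N s ⟶ Y)) :
    ∃ (K : Type w) (_ : Category.{w} K) (_ : IsCofiltered K) (F : K ⥤ D),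
      (∀ k, IsNormalObj (F.obj k)) ∧ IsWeaklyInitialFunctor F := by
  obtain ⟨χ, hχ⟩ := exists_compatible_homs hepi hD hfin N hN
  let _ : Preorder S :=
    { le := fun i j => Nonempty (N i ⟶ N j)
      le_refl := fun i => ⟨𝟙 _⟩
      le_trans := fun i j k ⟨f⟩ ⟨g⟩ => ⟨f ≫ g⟩ }
  have : Nonempty S := (hweak (Classical.arbitrary D)).nonempty
  have : IsCodirectedOrder S := ⟨fun i j => by
    obtain ⟨Z, ⟨f⟩, ⟨g⟩⟩ := hD (N i) (N j)
    obtain ⟨s, ⟨h⟩⟩ := hweak Z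
    exact ⟨s, ⟨h ≫ f⟩, ⟨h ≫ g⟩⟩⟩
  let F : S ⥤ D :=
    { obj := N
      map := fun {i j} f => χ i j (leOfHom f)
      -- The chosen endomorphism is idempotent by compatibility, and an idempotent epimorphism is
      -- the identity.
      map_id := fun i => by
        have := hepi (χ i i (leOfHom (𝟙 i)))
        rw [← cancel_epi (χ i i (leOfHom (𝟙 i))), Category.comp_id]
        exact hχ _ _ _ _ _ _
      map_comp := fun f g => (hχ _ _ _ _ _ _).symm }
  exact ⟨S, inferInstance, inferInstance, F, hN, hweak⟩

theorem exists_tower_of_countable (hD : IsLambdaConnected D)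
    (hnormal : ∀ Y : D, ∃ Z : D, IsNormalObj Z ∧ Nonempty (Z ⟶ Y)) (s : ℕ → D)
    (hweak : ∀ Y : D, ∃ n, Nonempty (s n ⟶ Y)) :
    ∃ (K : Type w) (_ : Category.{w} K) (_ : IsCofiltered K) (F : K ⥤ D),
      (∀ k, IsNormalObj (F.obj k)) ∧ IsWeaklyInitialFunctor F := by
  have step : ∀ Y Y' : D, ∃ Z : D, IsNormalObj Z ∧ Nonempty (Z ⟶ Y) ∧ Nonempty (Z ⟶ Y') := by
    intro Y Y'
    obtain ⟨W, ⟨f⟩, ⟨g⟩⟩ := hD Y Y'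
    obtain ⟨Z, hZ, ⟨h⟩⟩ := hnormal W
    exact ⟨Z, hZ, ⟨h ≫ f⟩, ⟨h ≫ g⟩⟩
  choose Z hZ hZ₁ hZ₂ using step
  let X : ℕ → D := fun n => Nat.rec (Z (s 0) (s 0)) (fun n Y => Z Y (s (n + 1))) n
  have hX : ∀ n, IsNormalObj (X n) := by
    rintro (_ | n) <;> exact hZ _ _
  have hXs : ∀ n, Nonempty (X n ⟶ s n) := by
    rintro (_ | n) <;> exact hZ₂ _ _
  let F : ℕᵒᵖ ⥤ D := Functor.ofOpSequence (X := X) fun n => (hZ₁ (X n) (s (n + 1))).some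
  -- The index category must live in the universe `w`, as in the finite case.
  let e : ℕᵒᵖ ≌ ULiftHom.{w} (ULift.{w} ℕᵒᵖ) := ULiftHomULiftCategory.equiv.{w, w} ℕᵒᵖ
  refine ⟨ULiftHom.{w} (ULift.{w} ℕᵒᵖ), inferInstance, IsCofiltered.of_equivalence e,
    e.inverse ⋙ F, fun k => hX _, fun Y => ?_⟩
  obtain ⟨n, ⟨f⟩⟩ := hweak Y
  obtain ⟨g⟩ := hXs n
  exact ⟨e.functor.obj (Opposite.op n), ⟨g ≫ f⟩⟩

theorem exists_tower (hepi : ∀ {X Y : D} (f : X ⟶ Y), Epi f)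
    (hD : IsLambdaConnected D) [Nonempty D]
    (hnormal : ∀ Y : D, ∃ Z : D, IsNormalObj Z ∧ Nonempty (Z ⟶ Y))
    {S : Type w} (N : S → D) (hweak : ∀ Y : D, ∃ s, Nonempty (N s ⟶ Y))
    (hcard : CardinalityOne D ∨ CardinalityTwo D) :
    ∃ (K : Type w) (_ : Category.{w} K) (_ : IsCofiltered K) (F : K ⥤ D),
      (∀ k, IsNormalObj (F.obj k)) ∧ IsWeaklyInitialFunctor F := by
  rcases hcard with hfin | ⟨T, hT, hTweak⟩
  · choose Z hZ hZf using hnormal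
    refine exists_tower_of_finite_hom hepi hD hfin (fun s => Z (N s)) (fun s => hZ _) fun Y => ?_
    obtain ⟨s, ⟨f⟩⟩ := hweak Y
    exact ⟨s, (hZf (N s)).map (· ≫ f)⟩
  · have hne : T.Nonempty := by
      obtain ⟨Y, hY, _⟩ := hTweak (Classical.arbitrary D)
      exact ⟨Y, hY⟩
    obtain ⟨s, rfl⟩ := hT.exists_eq_range hne
    refine exists_tower_of_countable hD hnormal s fun Y => ?_
    obtain ⟨_, ⟨n, rfl⟩, h⟩ := hTweak Y
    exact ⟨n, h⟩

end Towers

/-! ### The category of germs from a pro-object and the grid it gives -/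

section Germs

variable {C : Type u} [Category.{v} C] {K : Type w} [Category.{w} K]

/-- An object of `C` together with a representative `U.obj k ⟶ pt` of a germ of morphisms from
the pro-object `U`. -/
structure PointedObj (U : K ⥤ C) where
  index : K
  pt : C
  point : U.obj index ⟶ pt

namespace PointedObj

variable {U : K ⥤ C}

/-- A morphism of `C` that sends the germ of `e` to the germ of `e'`. -/
@[ext]
structure Hom (e e' : PointedObj U) where
  hom : e.pt ⟶ e'.pt
  germ_eq : ∃ (k : K) (a : k ⟶ e.index) (b : k ⟶ e'.index),
    U.map a ≫ e.point ≫ hom = U.map b ≫ e'.point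

variable [IsCofiltered K]

@[simps]
instance : Category (PointedObj U) where
  Hom := Hom
  id e := ⟨𝟙 _, e.index, 𝟙 _, 𝟙 _, by simp⟩
  comp {e₁ e₂ e₃} f g := ⟨f.hom ≫ g.hom, by
    obtain ⟨k, a, b, h⟩ := f.germ_eq
    obtain ⟨l, c, d, h'⟩ := g.germ_eq
    obtain ⟨m, p, q, hpq⟩ := IsCofiltered.cospan b c
    refine ⟨m, p ≫ a, q ≫ d, ?_⟩
    rw [U.map_comp, U.map_comp, Category.assoc, Category.assoc, ← h', ← Category.assoc (U.map q),
      ← U.map_comp, ← hpq, U.map_comp, Category.assoc, ← Category.assoc (U.map b), ← h]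
    simp only [Category.assoc]⟩

@[ext]
theorem hom_ext {e e' : PointedObj U} {f g : e ⟶ e'} (h : Hom.hom f = Hom.hom g) : f = g :=
  Hom.ext h

variable (U) in
/-- The functor that forgets the point. -/
@[simps]
def forget : PointedObj U ⥤ C where
  obj := pt
  map f := Hom.hom f

/-- After refinement to a common index, both morphisms have the same composite with one
representative of the source germ, which is an epimorphism. -/
theorem isThin (hepi : ∀ {X Y : C} (f : X ⟶ Y), Epi f) : Quiver.IsThin (PointedObj U) := by
  refine fun e e' => ⟨fun f g => hom_ext ?_⟩
  obtain ⟨k, a, b, h⟩ := f.germ_eq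
  obtain ⟨l, c, d, h'⟩ := g.germ_eq
  obtain ⟨m, p, q, hac, hbd⟩ := IsCofiltered.bowtie a c b d
  have := hepi (U.map (p ≫ a) ≫ e.point)
  rw [← cancel_epi (U.map (p ≫ a) ≫ e.point)]
  have h₁ : (U.map (p ≫ a) ≫ e.point) ≫ f.hom = U.map (p ≫ b) ≫ e'.point := by
    simp only [U.map_comp, Category.assoc, h]
  have h₂ : (U.map (q ≫ c) ≫ e.point) ≫ g.hom = U.map (q ≫ d) ≫ e'.point := by
    simp only [U.map_comp, Category.assoc, h']
  rw [h₁, hac, h₂, hbd]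

theorem isLambdaConnected : IsLambdaConnected (PointedObj U) := fun e e' =>
  let k := IsCofiltered.min e.index e'.index
  ⟨⟨k, U.obj k, 𝟙 _⟩,
    ⟨⟨U.map (IsCofiltered.minToLeft _ _) ≫ e.point, k, 𝟙 _, IsCofiltered.minToLeft _ _,
      by simp [k]⟩⟩,
    ⟨⟨U.map (IsCofiltered.minToRight _ _) ≫ e'.point, k, 𝟙 _, IsCofiltered.minToRight _ _,
      by simp [k]⟩⟩⟩

theorem under_post_isEquivalence (e : PointedObj U) :
    (Under.post (forget U) : Under e ⥤ Under e.pt).IsEquivalence where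
  faithful := ⟨fun {A B} f g h => by
    ext
    exact congrArg (fun φ => φ.right) h⟩
  full := ⟨fun {A B} f => by
    obtain ⟨k, a, b, h⟩ := A.hom.germ_eq
    obtain ⟨l, c, d, h'⟩ := B.hom.germ_eq
    let r : A.right.pt ⟶ B.right.pt := f.right
    have hf : Hom.hom A.hom ≫ r = Hom.hom B.hom := Under.w f
    obtain ⟨m, p, q, hpq⟩ := IsCofiltered.cospan a c
    let φ : A.right ⟶ B.right := ⟨r, m, p ≫ b, q ≫ d, by
      have h₁ := congrArg (fun x => U.map p ≫ x ≫ r) h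
      have h₂ := congrArg (fun x => U.map q ≫ x) h'
      have h₃ := congrArg U.map hpq
      simp only [U.map_comp, Category.assoc] at h₁ h₂ h₃ ⊢
      rw [← h₂, ← h₁, hf, ← Category.assoc, h₃, Category.assoc]⟩
    exact ⟨Under.homMk φ (hom_ext hf), by ext; rfl⟩⟩
  essSurj := ⟨fun Z => by
    let e' : PointedObj U := ⟨e.index, Z.right, e.point ≫ Z.hom⟩
    let φ : e ⟶ e' := ⟨Z.hom, e.index, 𝟙 _, 𝟙 _, by simp [e']⟩
    exact ⟨Under.mk φ, ⟨Under.isoMk (Iso.refl _) (Category.comp_id _)⟩⟩⟩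

/-- By thinness only isomorphism classes need counting, and each is represented by a germ whose
target comes from the small model of `C`. -/
theorem essentiallySmall [EssentiallySmall.{w} C] (hepi : ∀ {X Y : C} (f : X ⟶ Y), Epi f) :
    EssentiallySmall.{w} (PointedObj U) := by
  have := isThin (U := U) hepi
  rw [essentiallySmall_iff_of_thin]
  let E := equivSmallModel.{w} C
  let g : (Σ (k : K) (A : SmallModel.{w} C), (U.obj k ⟶ E.inverse.obj A)) →
      Skeleton (PointedObj U) := fun x => toSkeleton ⟨x.1, E.inverse.obj x.2.1, x.2.2⟩
  refine small_of_surjective (f := g) fun q => ?_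
  let e := (fromSkeleton _).obj q
  let i := E.unitIso.app e.pt
  refine ⟨⟨e.index, E.functor.obj e.pt, e.point ≫ i.hom⟩, ?_⟩
  rw [← toSkeleton_fromSkeleton_obj q]
  refine congr_toSkeleton_of_iso ⟨⟨i.inv, e.index, 𝟙 _, 𝟙 _, ?_⟩, ⟨i.hom, e.index, 𝟙 _, 𝟙 _, ?_⟩,
    Subsingleton.elim _ _, Subsingleton.elim _ _⟩
  · simp [e]
  · simp [e]

end PointedObj

theorem exists_grid_of_proObject (J : GrothendieckTopology C) (hJ : IsBSite J)
    [EssentiallySmall.{w} C] [IsCofiltered K] (U : K ⥤ C)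
    (hU : ∀ {k l : K} (a : k ⟶ l), coverMor J (U.map a))
    (hcover : ∀ Y : C, ∃ (k : K) (y : U.obj k ⟶ Y), coverMor J y)
    (hlift : ∀ (k : K) {Y Z : C} (y : U.obj k ⟶ Y) (f : Z ⟶ Y), coverMor J f →
      ∃ (j : K) (a : j ⟶ k) (z : U.obj j ⟶ Z), z ≫ f = U.map a ≫ y) :
    ∃ (P : Type w) (_ : PartialOrder P) (ι : P ⥤ C), IsGrid J ι := by
  have := PointedObj.isThin (U := U) hJ.epi
  have := PointedObj.essentiallySmall (U := U) hJ.epi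
  let E := equivSmallModel.{w} (PointedObj U)
  have : Quiver.IsThin (SmallModel.{w} (PointedObj U)) := fun A B =>
    ⟨fun f g => E.inverse.map_injective (Subsingleton.elim _ _)⟩
  let Φ : ThinSkeleton (SmallModel.{w} (PointedObj U)) ≌ PointedObj U :=
    (ThinSkeleton.equivalence _).trans E.symm
  refine ⟨ThinSkeleton (SmallModel.{w} (PointedObj U)), inferInstance,
    Φ.functor ⋙ PointedObj.forget U, ?_, ?_, ?_, ?_⟩
  · intro X Y
    obtain ⟨e, ⟨f⟩, ⟨g⟩⟩ := PointedObj.isLambdaConnected (Φ.functor.obj X) (Φ.functor.obj Y)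
    let i := Φ.counitIso.app e
    exact ⟨Φ.inverse.obj e, ⟨Φ.functor.preimage (i.hom ≫ f)⟩, ⟨Φ.functor.preimage (i.hom ≫ g)⟩⟩
  · intro Y
    obtain ⟨k, y, hy⟩ := hcover Y
    let e : PointedObj U := ⟨k, Y, y⟩
    let i : Φ.functor.obj (Φ.inverse.obj e) ≅ e := Φ.counitIso.app e
    refine ⟨Φ.inverse.obj e, fun A f => ?_, ⟨(PointedObj.forget U).mapIso i⟩⟩
    obtain ⟨l, a, b, h⟩ := (Φ.functor.map f ≫ i.hom).germ_eq
    -- A germ with a representative in `𝒯(J)` gives an edge object: this composite factors through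
    -- the morphism in question, and `𝒯(J)` contains the factors of its members.
    have h₁ : coverMor J (U.map b ≫ y) := (coverMor J).comp_mem _ _ (hU b) hy
    have h₂ : coverMor J ((Φ.functor.map f).hom ≫ i.hom.hom) := by
      change _ = U.map b ≫ y at h
      rw [← h, hJ.comp_iff, hJ.comp_iff] at h₁
      exact h₁.1.1
    exact ((hJ.comp_iff _ _).1 h₂).2
  · intro X Z f hf
    obtain ⟨j, a, z, hz⟩ := hlift _ (Φ.functor.obj X).point f hf
    let e : PointedObj U := ⟨j, Z, z⟩
    let φ : e ⟶ Φ.functor.obj X := ⟨f, j, 𝟙 _, a, by simpa [e] using hz⟩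
    let i : Φ.functor.obj (Φ.inverse.obj e) ≅ e := Φ.counitIso.app e
    refine ⟨Φ.inverse.obj e, Φ.functor.preimage (i.hom ≫ φ),
      (PointedObj.forget U).mapIso i.symm, ?_⟩
    have h : i.inv ≫ i.hom ≫ φ = φ := by simp
    rw [Functor.comp_map, Functor.map_preimage]
    exact (congrArg PointedObj.Hom.hom h).symm
  · intro X
    have := PointedObj.under_post_isEquivalence (Φ.functor.obj X)
    rw [Under.post_comp]
    have : (Under.post (PointedObj.forget U) : Under (Φ.functor.obj X) ⥤ _).IsEquivalence := this
    infer_instance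

end Germs

/-! ### The overcategory of `𝒞(𝒯(J))` and lifting of germs -/

section CoverCategory

variable {C : Type u} [Category.{v} C] {J : GrothendieckTopology C}

theorem IsATopology.ore (hJ : IsATopology J) {X Y₁ Y₂ : C} (f₁ : Y₁ ⟶ X) (f₂ : Y₂ ⟶ X)
    (hf₁ : coverMor J f₁) :
    ∃ (Z : C) (g₁ : Z ⟶ Y₁) (g₂ : Z ⟶ Y₂), coverMor J g₂ ∧ g₁ ≫ f₁ = g₂ ≫ f₂ := by
  obtain ⟨T, -, hT⟩ := hJ
  have h := J.pullback_stable f₂ hf₁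
  rw [hT] at h
  obtain ⟨Z, g₂, ⟨_, g₁, _, ⟨⟩, hg⟩, hg₂⟩ := h
  refine ⟨Z, g₁, g₂, ?_, hg⟩
  change _ ∈ J _
  rw [hT]
  exact ⟨Z, g₂, Sieve.le_generate _ _ _ (Presieve.singleton_self _), hg₂⟩

theorem galoisCovering.exists_comp_eq {X Y Z : C} {f : Y ⟶ X} (hf : galoisCovering C f)
    (s t : Z ⟶ Y) (h : s ≫ f = t ≫ f) : ∃ σ : Y ⟶ Y, σ ≫ f = f ∧ t ≫ σ = s := by
  obtain ⟨G, _, ρ, hρ⟩ := hf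
  let _ := homAction ρ Z
  obtain ⟨g, hg⟩ := (hρ Z).orbit s t h
  exact ⟨(ρ g).hom.left, Over.w (ρ g).hom, hg⟩

/-- The object of the overcategory given by a morphism of `𝒯(J)`. -/
abbrev overMk {X₀ : CoverCat J} {Y : C} (f : Y ⟶ X₀.obj) (hf : coverMor J f) : Over X₀ :=
  Over.mk (Y := (⟨Y⟩ : CoverCat J)) ⟨f, hf⟩

theorem over_w {X₀ : CoverCat J} {A B : Over X₀} (φ : A ⟶ B) :
    φ.left.hom ≫ B.hom.hom = A.hom.hom :=
  congrArg (fun ψ => ψ.hom) (Over.w φ)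

theorem over_hom_ext {X₀ : CoverCat J} {A B : Over X₀} {φ ψ : A ⟶ B}
    (h : φ.left.hom = ψ.left.hom) : φ = ψ :=
  Over.OverMorphism.ext (WideSubcategory.hom_ext _ h)

namespace IsBSite

variable {X₀ : CoverCat J}

theorem exists_over_hom (hJ : IsBSite J) {A B : Over X₀} (s : A.left.obj ⟶ B.left.obj)
    (hs : s ≫ B.hom.hom = A.hom.hom) : ∃ φ : A ⟶ B, φ.left.hom = s :=
  ⟨Over.homMk ⟨s, ((hJ.comp_iff _ B.hom.hom).1 (hs ▸ A.hom.property)).2⟩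
    (WideSubcategory.hom_ext _ hs), rfl⟩

theorem coverMor_of_isIso (hJ : IsBSite J) {X Y : C} (f : X ⟶ Y) [IsIso f] : coverMor J f := by
  have h : coverMor J (f ≫ inv f) := by
    rw [IsIso.hom_inv_id]
    exact (coverMor J).id_mem X
  exact ((hJ.comp_iff _ _).1 h).2

theorem epi_over (hJ : IsBSite J) {A B : Over X₀} (φ : A ⟶ B) : Epi φ where
  left_cancellation g h hgh := by
    have := hJ.epi φ.left.hom
    refine over_hom_ext ?_
    rw [← cancel_epi φ.left.hom]
    exact congrArg (fun ψ => ψ.left.hom) hgh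

theorem isLambdaConnected_over (hJ : IsBSite J) : IsLambdaConnected (Over X₀) := by
  intro A B
  obtain ⟨Z, g₁, g₂, hg₂, h⟩ := hJ.aTopology.ore A.hom.hom B.hom.hom A.hom.property
  let W : Over X₀ := overMk (g₂ ≫ B.hom.hom) ((coverMor J).comp_mem _ _ hg₂ B.hom.property)
  obtain ⟨φ, -⟩ := hJ.exists_over_hom (A := W) (B := A) g₁ h
  obtain ⟨ψ, -⟩ := hJ.exists_over_hom (A := W) (B := B) g₂ rfl
  exact ⟨W, ⟨φ⟩, ⟨ψ⟩⟩

theorem isNormalObj_overMk (hJ : IsBSite J) {Y : C} (f : Y ⟶ X₀.obj) (hf : coverMor J f)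
    (hgal : galoisCovering C f) : IsNormalObj (overMk (X₀ := X₀) f hf) := by
  intro W s t
  obtain ⟨σ, hσ, h⟩ := hgal.exists_comp_eq s.left.hom t.left.hom ((over_w s).trans (over_w t).symm)
  obtain ⟨φ, hφ⟩ := hJ.exists_over_hom (A := overMk (X₀ := X₀) f hf) (B := overMk f hf) σ hσ
  refine ⟨φ, over_hom_ext ?_⟩
  change t.left.hom ≫ φ.left.hom = s.left.hom
  rw [hφ, h]

theorem exists_isNormalObj (hJ : IsBSite J) (hgal : HasEnoughGalois (coverMor J)) (A : Over X₀) :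
    ∃ Z : Over X₀, IsNormalObj Z ∧ Nonempty (Z ⟶ A) := by
  have hA : hat (coverMor J) A.hom.hom :=
    ⟨_, 𝟙 _, (coverMor J).comp_mem _ _ ((coverMor J).id_mem _) A.hom.property⟩
  rw [← hgal] at hA
  obtain ⟨Z, g, hg, hg'⟩ := hA
  obtain ⟨φ, -⟩ := hJ.exists_over_hom (A := overMk (X₀ := X₀) (g ≫ A.hom.hom) hg) (B := A) g rfl
  exact ⟨_, hJ.isNormalObj_overMk _ hg hg', ⟨φ⟩⟩

theorem exists_small_weaklyInitial (hJ : IsBSite J) [EssentiallySmall.{w} C] (X₀ : CoverCat J) :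
    ∃ (S : Type w) (N : S → Over X₀), ∀ A : Over X₀, ∃ s, Nonempty (N s ⟶ A) := by
  let E := equivSmallModel.{w} C
  let S := Σ A : SmallModel.{w} C, {f : E.inverse.obj A ⟶ X₀.obj // coverMor J f}
  let e : Shrink.{w} S ≃ S := (equivShrink S).symm
  let N : S → Over X₀ := fun x => overMk x.2.1 x.2.2
  refine ⟨Shrink.{w} S, N ∘ e, fun A => ?_⟩
  let i := E.unitIso.inv.app A.left.obj
  let x : S := ⟨E.functor.obj A.left.obj, i ≫ A.hom.hom,
    (coverMor J).comp_mem _ _ (hJ.coverMor_of_isIso i) A.hom.property⟩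
  obtain ⟨s, hs⟩ := e.surjective x
  obtain ⟨φ, -⟩ := hJ.exists_over_hom (A := N x) (B := A) i rfl
  exact ⟨s, ⟨eqToHom (congrArg N hs) ≫ φ⟩⟩

/-- Germs from a weakly initial tower of normal objects lift along the morphisms of `𝒯(J)`. -/
theorem exists_germ_lift (hJ : IsBSite J) {K : Type*} [Category K] [IsCofiltered K]
    (F : K ⥤ Over X₀) (hF : ∀ k, IsNormalObj (F.obj k)) (hweak : IsWeaklyInitialFunctor F)
    (k : K) {Y Z : C} (y : (F.obj k).left.obj ⟶ Y) (f : Z ⟶ Y) (hf : coverMor J f) :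
    ∃ (j : K) (a : j ⟶ k) (z : (F.obj j).left.obj ⟶ Z), z ≫ f = (F.map a).left.hom ≫ y := by
  obtain ⟨W, g₁, g₂, hg₂, hg⟩ := hJ.aTopology.ore f y hf
  let V : Over X₀ := overMk (g₂ ≫ (F.obj k).hom.hom)
    ((coverMor J).comp_mem _ _ hg₂ (F.obj k).hom.property)
  obtain ⟨γ, hγ⟩ := hJ.exists_over_hom (A := V) (B := F.obj k) g₂ rfl
  obtain ⟨l, ⟨s'⟩⟩ := hweak V
  let j := IsCofiltered.min k l
  let a : j ⟶ k := IsCofiltered.minToLeft k l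
  let s : F.obj j ⟶ V := F.map (IsCofiltered.minToRight k l) ≫ s'
  -- The map `s ≫ γ`, which factors through `V`, need not be the transition map `F.map a`. The Ore
  -- condition equalizes them after `p` and `q`; normality of `F.obj j` turns this into an
  -- endomorphism `σ` with `σ ≫ s ≫ γ = F.map a`, so the transition map itself factors through `V`.
  obtain ⟨B, p, q, hq, hpq⟩ := hJ.aTopology.ore (s ≫ γ).left.hom (F.map a).left.hom
    (s ≫ γ).left.property
  let B' : Over X₀ := overMk (q ≫ (F.obj j).hom.hom)
    ((coverMor J).comp_mem _ _ hq (F.obj j).hom.property)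
  obtain ⟨q', hq'⟩ := hJ.exists_over_hom (A := B') (B := F.obj j) q rfl
  obtain ⟨p', hp'⟩ := hJ.exists_over_hom (A := B') (B := F.obj j) p (by
    change p ≫ _ = q ≫ _
    calc p ≫ (F.obj j).hom.hom = (p ≫ (s ≫ γ).left.hom) ≫ (F.obj k).hom.hom := by
          rw [Category.assoc, over_w]
      _ = q ≫ (F.obj j).hom.hom := by rw [hpq, Category.assoc, over_w])
  obtain ⟨σ, hσ⟩ := hF j p' q'
  have h : σ ≫ s ≫ γ = F.map a := by
    have := hJ.epi_over q'
    rw [← cancel_epi q', ← Category.assoc, hσ]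
    refine over_hom_ext ?_
    change p'.left.hom ≫ (s ≫ γ).left.hom = q'.left.hom ≫ (F.map a).left.hom
    rw [hp', hq', hpq]
  refine ⟨j, a, σ.left.hom ≫ s.left.hom ≫ g₁, ?_⟩
  rw [← h]
  change _ = (σ.left.hom ≫ s.left.hom ≫ γ.left.hom) ≫ y
  rw [hγ, Category.assoc, Category.assoc, hg]
  simp only [Category.assoc]

end IsBSite

end CoverCategory

end YSite

theorem proposition6p2 {C : Type u} [Category.{v} C] (J : GrothendieckTopology C)
    (hJ : YSite.IsYSite.{w} J)
    (hX₀ : ∃ X₀ : YSite.CoverCat J,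
      YSite.CardinalityOne (Over X₀) ∨ YSite.CardinalityTwo (Over X₀)) :
    ∃ (P : Type w) (_ : PartialOrder P) (ι : P ⥤ C), YSite.IsGrid J ι := by
  obtain ⟨X₀, hcard⟩ := hX₀
  have hB := hJ.toIsBSite
  have := hJ.essentiallySmall
  have : Nonempty (Over X₀) := ⟨Over.mk (𝟙 X₀)⟩
  obtain ⟨S, N, hN⟩ := hB.exists_small_weaklyInitial X₀
  obtain ⟨K, _, _, F, hF, hweak⟩ := YSite.exists_tower hB.epi_over hB.isLambdaConnected_over
    (hB.exists_isNormalObj hJ.enoughGalois) N hN hcard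
  refine YSite.exists_grid_of_proObject J hB
    (F ⋙ Over.forget X₀ ⋙ wideSubcategoryInclusion (YSite.coverMor J))
    (fun a => (F.map a).left.property) (fun Y => ?_)
    (fun k _ _ y f hf => hB.exists_germ_lift F hF hweak k y f hf)
  -- The object `Y` need not lie over `X₀`, but some `Z` over `X₀` maps to it in `𝒞(𝒯(J))`, and the
  -- tower reaches `Z`.
  obtain ⟨Z, ⟨f⟩, ⟨g⟩⟩ := hJ.lambdaConnected ⟨Y⟩ X₀
  obtain ⟨k, ⟨φ⟩⟩ := hweak (Over.mk g)
  exact ⟨k, (φ.left ≫ f).hom, (φ.left ≫ f).property⟩
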